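/- Work over $\mathbb C$ and let $n\ge 3$. Let $Z\subset\mathbb P^2$ be the set of points derived from the Fermat arrangement $\mathcal A_3^0(n)$, i.e. all points that are intersections of lines of the arrangement of linear factors of $(x^n-y^n)(x^n-z^n)(y^n-z^n)$. Then $Z$ consists of exactly $n^2+3$ points: if $\varepsilon$ is a primitive $n$-th root of unity, these are the points $(1:\varepsilon^\alpha:\varepsilon^\beta)$ with $1\le\alpha,\beta\le n$ and the three coordinate points $(1:0:0)$, $(0:1:0)$, $(0:0:1)$. Put $u=\binom n2-1$, $v=\binom{n-1}2$, $w=\binom{n+1}2$, and for $P=(a:b:c)\in\mathbb P^2$ let $$\begin{aligned}Q_P={}&-cxy\big((ub^n+vc^n)(z^n-x^n)+(ua^n+vc^n)(y^n-z^n)\big)\\&-bxz\big((ua^n+vb^n)(y^n-z^n)+(uc^n+vb^n)(x^n-y^n)\big)\\&-ayz\big((ub^n+va^n)(z^n-x^n)+(uc^n+va^n)(x^n-y^n)\big)\\&+wa^{n-1}bc\,x^2(y^n-z^n)+wab^{n-1}c\,y^2(z^n-x^n)+wabc^{n-1}z^2(x^n-y^n).\end{aligned}$$ Then for a general point $P=(a:b:c)$,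 i.e. for all $P$ in some non-empty Zariski open subset of $\mathbb P^2$ (depending on $n$), the polynomial $Q_P$ - vanishes at all points of $Z$; - vanishes at $P$ to order exactly $4$, i.e. $Q_P\in I(P)^4\setminus I(P)^5$, where $I(P)$ is the homogeneous ideal of $P$; - defines an unexpected curve of degree $n+2$ for $Z$ with respect to $4P$: $Q_P$ is a nonzero form of degree $n+2$ in $I(Z)\cap I(P)^4$, and $$\dim_{\mathbb C}\,[I(Z)\cap I(P)^4]_{n+2}\;>\;\max\Big\{\dim_{\mathbb C}\,[I(Z)]_{n+2}-\binom{5}{2},\;0\Big\},$$ where $I(Z)$ is the homogeneous ideal of $Z$ and $[I]_d$ is the space of forms of degree $d$ in $I$. -/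

import Mathlib

open MvPolynomial

noncomputable section

namespace FermatCurves

/-- The complex projective space of dimension `N`. -/
abbrev ProjSpace (N : ℕ) : Type := Projectivization ℂ (Fin (N + 1) → ℂ)

/-- The homogeneous coordinate ring of `ProjSpace N`. -/
abbrev CoordRing (N : ℕ) : Type := MvPolynomial (Fin (N + 1)) ℂ

/-! ### Arrangements and derived configurations -/

/-- The Fermat arrangement in projective `N`-space: all hyperplanes `x_i = ζ x_j` with `i < j` and
`ζ` an `n`-th root of unity. A linear subspace of the projective space is given by the
corresponding vector subspace. -/
def fermatArrangement (N n : ℕ) : Set (Submodule ℂ (Fin (N + 1) → ℂ)) :=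
  {H | ∃ i j : Fin (N + 1), i < j ∧ ∃ ζ : ℂ, ζ ^ n = 1 ∧
    H = LinearMap.ker
      ((LinearMap.proj i : (Fin (N + 1) → ℂ) →ₗ[ℂ] ℂ) - ζ • LinearMap.proj j)}

/-- All intersections of members of the arrangement `𝓗` that are non-empty in the projective
space, that is, nonzero as vector subspaces. -/
def intersectionLattice {N : ℕ} (𝓗 : Set (Submodule ℂ (Fin (N + 1) → ℂ))) :
    Set (Submodule ℂ (Fin (N + 1) → ℂ)) :=
  {L | L ≠ ⊥ ∧ ∃ S ⊆ 𝓗, L = sInf S}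

/-- The union of all flats of projective dimension `t` in the intersection lattice of `𝓗`. -/
def derivedConfiguration {N : ℕ} (𝓗 : Set (Submodule ℂ (Fin (N + 1) → ℂ))) (t : ℕ) :
    Set (ProjSpace N) :=
  {p | ∃ L ∈ intersectionLattice 𝓗, Module.finrank ℂ L = t + 1 ∧ p.submodule ≤ L}

/-- The points of the projective plane derived from the Fermat arrangement of lines. -/
def fermatPoints (n : ℕ) : Set (ProjSpace 2) :=
  derivedConfiguration (fermatArrangement 2 n) 0

/-! ### Ideals of points, multiplicity, general points -/

/-- The homogeneous ideal `I(p)` of a point: all polynomials that vanish on the line through the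
origin which represents `p`. -/
def pointIdeal {N : ℕ} (p : ProjSpace N) : Ideal (CoordRing N) :=
  vanishingIdeal ℂ (p.submodule : Set (Fin (N + 1) → ℂ))

/-- The homogeneous ideal of a set of reduced points. -/
def pointsIdeal {N : ℕ} (Z : Set (ProjSpace N)) : Ideal (CoordRing N) :=
  ⨅ p ∈ Z, pointIdeal p

/-- The form `f` vanishes at the point `p`. -/
def VanishesAt {N : ℕ} (f : CoordRing N) (p : ProjSpace N) : Prop :=
  ∀ v ∈ p.submodule, eval v f = 0

/-- The form `f` vanishes at `p` to order exactly `m`. -/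
def VanishesToOrder {N : ℕ} (f : CoordRing N) (p : ProjSpace N) (m : ℕ) : Prop :=
  f ∈ pointIdeal p ^ m ∧ f ∉ pointIdeal p ^ (m + 1)

/-- Zariski open subsets of the projective space: complements of common zero sets of families of
forms. -/
def IsZariskiOpen {N : ℕ} (U : Set (ProjSpace N)) : Prop :=
  ∃ S : Set (CoordRing N), (∀ f ∈ S, ∃ k : ℕ, f.IsHomogeneous k) ∧
    U = {p | ∃ f ∈ S, ¬ VanishesAt f p}

/-! ### Unexpected hypersurfaces -/

/-- The dimension of the space of forms of degree `d` in the ideal `I`. For the saturated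
homogeneous ideals used below this is `h⁰(𝒪(d) ⊗ I)`. -/
def h0 {N : ℕ} (d : ℕ) (I : Ideal (CoordRing N)) : ℕ :=
  Module.finrank ℂ
    ↥(homogeneousSubmodule (Fin (N + 1)) ℂ d ⊓ I.restrictScalars ℂ)

/-- The form `f` defines an unexpected hypersurface of degree `d` for the set of points `Z` with
respect to the fat point `m R`: it is a nonzero form of degree `d` in `I(Z + m R)`, and
`h⁰(𝒪(d) ⊗ I(Z + m R)) > max (h⁰(𝒪(d) ⊗ I(Z)) - binom (N + m - 1) N, 0)`. -/
structure DefinesUnexpected {N : ℕ} (f : CoordRing N) (d : ℕ) (Z : Set (ProjSpace N))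
    (m : ℕ) (R : ProjSpace N) : Prop where
  ne_zero : f ≠ 0
  isHomogeneous : f.IsHomogeneous d
  mem : f ∈ pointsIdeal Z ⊓ pointIdeal R ^ m
  unexpected : (h0 d (pointsIdeal Z ⊓ pointIdeal R ^ m) : ℤ) >
    max ((h0 d (pointsIdeal Z) : ℤ) - ((N + m - 1).choose N : ℤ)) 0

/-! ### The explicit polynomial -/

/-- The polynomial `Q_P` in `x = X 0`, `y = X 1`, `z = X 2` attached to `P = (a : b : c)`. -/
def unexpectedPolynomial (n : ℕ) (a b c : ℂ) : CoordRing 2 :=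
  let x : CoordRing 2 := X 0
  let y : CoordRing 2 := X 1
  let z : CoordRing 2 := X 2
  let u : ℂ := (n.choose 2 : ℂ) - 1
  let v : ℂ := ((n - 1).choose 2 : ℂ)
  let w : ℂ := ((n + 1).choose 2 : ℂ);
  - C c * x * y * (C (u * b ^ n + v * c ^ n) * (z ^ n - x ^ n)
      + C (u * a ^ n + v * c ^ n) * (y ^ n - z ^ n))
  - C b * x * z * (C (u * a ^ n + v * b ^ n) * (y ^ n - z ^ n)
      + C (u * c ^ n + v * b ^ n) * (x ^ n - y ^ n))
  - C a * y * z * (C (u * b ^ n + v * a ^ n) * (z ^ n - x ^ n)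
      + C (u * c ^ n + v * a ^ n) * (x ^ n - y ^ n))
  + C (w * a ^ (n - 1) * b * c) * x ^ 2 * (y ^ n - z ^ n)
  + C (w * a * b ^ (n - 1) * c) * y ^ 2 * (z ^ n - x ^ n)
  + C (w * a * b * c ^ (n - 1)) * z ^ 2 * (x ^ n - y ^ n)

end FermatCurves

end

namespace FermatCurves

/-! Write `P = (a : b : c)` with `abc ≠ 0` and rescale to `X = x/a`, `Y = y/b`, `Z = z/c`, so that
`P` becomes `(1 : 1 : 1)` and `s = Y - X`, `t = Z - X` lie in `I(P)`. Expanding `Y ^ n = (X + s) ^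
n` and `Z ^ n = (X + t) ^ n` to third order turns `Q_P` into a combination of monomials in `s` and
`t`. The values of `u`, `v`, `w` make everything of order below 4 cancel (`twelve_mul_mem`), hence
`Q_P ∈ I(P) ^ 4`. On the line through `P` along which only `y` varies, the fourth-order coefficient
is a nonzero multiple of `abc * b ^ n * (a ^ n - c ^ n)` (`coeff_four_restrictLine`), so the order
is exactly 4 when this is nonzero, which is an open condition.

Unexpectedness reduces to an upper bound: `[I(Z)]_{n+2}` has dimension at most 10, the number of
conditions expected of a fourfold point, so the right-hand maximum is 0, whereas `Q_P` is a nonzero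
element on the left. The bound comes from Fourier analysis on the grid `(1 : ε ^ α : ε ^ β)`:
vanishing there makes the coefficients sum to zero over each residue class of exponents modulo `n`,
so ten coefficients determine the form (`eq_zero_of_coeff_determiningExponents`). -/

/-! ### Point ideals in terms of values -/

theorem mem_pointIdeal {N : ℕ} {p : ProjSpace N} {f : CoordRing N} :
    f ∈ pointIdeal p ↔ VanishesAt f p := by
  simp only [pointIdeal, mem_vanishingIdeal_iff, VanishesAt, SetLike.mem_coe]
  rfl

theorem mem_pointsIdeal {N : ℕ} {Z : Set (ProjSpace N)} {f : CoordRing N} :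
    f ∈ pointsIdeal Z ↔ ∀ p ∈ Z, VanishesAt f p := by
  simp [pointsIdeal, mem_pointIdeal]

theorem vanishesAt_mk {N : ℕ} {f : CoordRing N} {v : Fin (N + 1) → ℂ} (hv : v ≠ 0) :
    VanishesAt f (Projectivization.mk ℂ v hv) ↔ ∀ k : ℂ, eval (k • v) f = 0 := by
  simp [VanishesAt, Projectivization.submodule_mk, Submodule.mem_span_singleton]

/-! ### The derived points of the Fermat arrangement -/

/-- A point is derived from the Fermat arrangement iff it is the intersection of all the members
of the arrangement that contain it. -/
theorem mk_mem_derived_iff {N n : ℕ} {v : Fin (N + 1) → ℂ} (hv : v ≠ 0) :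
    Projectivization.mk ℂ v hv ∈ derivedConfiguration (fermatArrangement N n) 0 ↔
      ∀ x : Fin (N + 1) → ℂ, (∀ i j, i < j → ∀ ζ : ℂ, ζ ^ n = 1 → v i = ζ * v j → x i = ζ * x j) →
        ∃ k : ℂ, k • v = x := by
  set p := Projectivization.mk ℂ v hv with hp
  have hsub : p.submodule = ℂ ∙ v := Projectivization.submodule_mk v hv
  constructor
  · rintro ⟨L, ⟨-, S, hS, rfl⟩, hL, hle⟩ x hx
    -- A flat of vector-space dimension 1 containing the line `p.submodule` equals it.
    have hLp : p.submodule = sInf S :=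
      Submodule.eq_of_le_of_finrank_eq hle (by rw [hL, p.finrank_submodule])
    rw [← Submodule.mem_span_singleton, ← hsub, hLp, Submodule.mem_sInf]
    intro H hH
    obtain ⟨i, j, hij, ζ, hζ, rfl⟩ := hS hH
    have hvH : v ∈ sInf S := by rw [← hLp, hsub]; exact Submodule.mem_span_singleton_self v
    have := (Submodule.mem_sInf.1 hvH) _ hH
    simp only [LinearMap.mem_ker, LinearMap.sub_apply, LinearMap.smul_apply, LinearMap.proj_apply,
      smul_eq_mul, sub_eq_zero] at this ⊢
    exact hx i j hij ζ hζ this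
  · intro h
    have heq : p.submodule = sInf {H | H ∈ fermatArrangement N n ∧ p.submodule ≤ H} := by
      refine le_antisymm (le_sInf fun H hH => hH.2) fun x hx => ?_
      rw [hsub, Submodule.mem_span_singleton]
      refine h x fun i j hij ζ hζ hvij => ?_
      have := (Submodule.mem_sInf.1 hx) (LinearMap.ker
        ((LinearMap.proj i : (Fin (N + 1) → ℂ) →ₗ[ℂ] ℂ) - ζ • LinearMap.proj j))
        ⟨⟨i, j, hij, ζ, hζ, rfl⟩, by simp [hsub, Submodule.span_singleton_le_iff_mem, hvij]⟩
      simpa [sub_eq_zero] using this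
    refine ⟨p.submodule, ⟨?_, _, fun H hH => hH.1, heq⟩, by simp [p.finrank_submodule], le_rfl⟩
    intro h0
    have := p.finrank_submodule
    rw [h0] at this
    simp at this

theorem eq_of_no_isolated_value {α : Type*} (w : Fin 3 → α) (h : ∀ i, ∃ j, j ≠ i ∧ w j = w i) :
    w 0 = w 1 ∧ w 0 = w 2 := by
  obtain ⟨a, ha, ha'⟩ := h 0
  obtain ⟨b, hb, hb'⟩ := h 1
  obtain ⟨c, hc, hc'⟩ := h 2
  fin_cases a <;> fin_cases b <;> fin_cases c <;> simp at ha hb hc ha' hb' hc' <;> grind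

/-- A line `x_i = ζ x_j` passes through `v` only if `v i ^ n = v j ^ n`, so the pattern of equal
`n`-th powers among the coordinates decides whether the lines through `v` cut out a single point. -/
theorem mk_mem_fermatPoints_iff {n : ℕ} (hn : 3 ≤ n) {v : Fin 3 → ℂ} (hv : v ≠ 0) :
    Projectivization.mk ℂ v hv ∈ fermatPoints n ↔
      (v 0 ≠ 0 ∧ v 0 ^ n = v 1 ^ n ∧ v 0 ^ n = v 2 ^ n) ∨ ∃ i, ∀ j, j ≠ i → v j = 0 := by
  have hn0 : n ≠ 0 := by omega
  unfold fermatPoints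
  rw [mk_mem_derived_iff]
  constructor
  · intro h
    by_cases hi : ∃ i, ∀ j, j ≠ i → v j ^ n ≠ v i ^ n
    · right
      obtain ⟨i, hi⟩ := hi
      -- No line through `v` involves the `i`-th coordinate, so all of them contain the `i`-th
      -- coordinate point, which must then be `v`.
      obtain ⟨k, hk⟩ := h (Pi.single i 1) (by
        intro a b hab ζ hζ hv
        have hpow : v a ^ n = v b ^ n := by rw [hv, mul_pow, hζ, one_mul]
        have ha : a ≠ i := by rintro rfl; exact hi b hab.ne' hpow.symm
        have hb : b ≠ i := by rintro rfl; exact hi a hab.ne hpow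
        simp [ha, hb])
      refine ⟨i, fun j hj => ?_⟩
      have h1 := congrFun hk i
      have h2 := congrFun hk j
      simp only [Pi.smul_apply, smul_eq_mul, Pi.single_eq_same, Pi.single_eq_of_ne hj] at h1 h2
      exact (mul_eq_zero.1 h2).resolve_left (by rintro rfl; simp at h1)
    · left
      push Not at hi
      have key : v 0 ^ n = v 1 ^ n ∧ v 0 ^ n = v 2 ^ n :=
        eq_of_no_isolated_value (v · ^ n) hi
      refine ⟨fun h0 => hv ?_, key⟩
      rw [h0, zero_pow hn0] at key
      have h1 := eq_zero_of_pow_eq_zero key.1.symm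
      have h2 := eq_zero_of_pow_eq_zero key.2.symm
      funext j
      fin_cases j <;> simp_all
  · rintro (⟨h0, h1, h2⟩ | ⟨i, hi⟩) x hx
    · have hv1 : v 1 ≠ 0 := by
        intro h; rw [h, zero_pow hn0] at h1; exact h0 (eq_zero_of_pow_eq_zero h1)
      have hv2 : v 2 ≠ 0 := by
        intro h; rw [h, zero_pow hn0] at h2; exact h0 (eq_zero_of_pow_eq_zero h2)
      have e1 := hx 0 1 (by decide) (v 0 / v 1)
        (by rw [div_pow, h1, div_self (pow_ne_zero _ hv1)]) (by field_simp)
      have e2 := hx 0 2 (by decide) (v 0 / v 2)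
        (by rw [div_pow, h2, div_self (pow_ne_zero _ hv2)]) (by field_simp)
      refine ⟨x 0 / v 0, funext fun j => ?_⟩
      fin_cases j
      · simp [h0]
      · change x 0 / v 0 * v 1 = x 1
        rw [e1]; field_simp
      · change x 0 / v 0 * v 2 = x 2
        rw [e2]; field_simp
    · have hvi : v i ≠ 0 := by
        intro h
        refine hv (funext fun j => ?_)
        by_cases hj : j = i
        · rw [hj, h]; rfl
        · exact hi j hj
      have hε := Complex.isPrimitiveRoot_exp n hn0
      set ε := Complex.exp (2 * Real.pi * Complex.I / n)
      have hε1 : ε ≠ 1 := hε.ne_one (by omega)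
      -- The two lines `x_j = x_k` and `x_j = ε x_k` are distinct because `ε ≠ 1`; together they
      -- force both coordinates to vanish.
      have pair : ∀ j k, j < k → j ≠ i → k ≠ i → x j = 0 ∧ x k = 0 := by
        intro j k hjk hj hk
        have e1 := hx j k hjk 1 (one_pow _) (by simp [hi j hj, hi k hk])
        have e2 := hx j k hjk ε hε.pow_eq_one (by simp [hi j hj, hi k hk])
        have : (1 - ε) * x k = 0 := by linear_combination e2 - e1
        have hk0 : x k = 0 := (mul_eq_zero.1 this).resolve_left (sub_ne_zero.2 hε1.symm)
        exact ⟨by rw [e1, hk0, mul_zero], hk0⟩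
      have hx0 : ∀ j, j ≠ i → x j = 0 := by
        intro j hj
        obtain ⟨k, hkj, hki⟩ : ∃ k, k ≠ j ∧ k ≠ i :=
          (by decide : ∀ j i : Fin 3, ∃ k, k ≠ j ∧ k ≠ i) j i
        rcases lt_or_gt_of_ne hkj with h | h
        · exact (pair k j h hki hj).2
        · exact (pair j k h hj hki).1
      refine ⟨x i / v i, funext fun j => ?_⟩
      by_cases hj : j = i
      · subst hj; simp [hvi]
      · simp [hi j hj, hx0 j hj]

theorem one_ne {a b : ℂ} : (![1, a, b] : Fin 3 → ℂ) ≠ 0 := fun h => by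
  simpa using congrFun h 0

theorem mem_fermatPoints_iff {n : ℕ} (hn : 3 ≤ n) {ε : ℂ} (hε : IsPrimitiveRoot ε n)
    (p : ProjSpace 2) :
    p ∈ fermatPoints n ↔
        (∃ α ∈ Finset.Icc 1 n, ∃ β ∈ Finset.Icc 1 n,
          ∃ h : ![1, ε ^ α, ε ^ β] ≠ 0, p = Projectivization.mk ℂ ![1, ε ^ α, ε ^ β] h) ∨
        (∃ h : ![(1 : ℂ), 0, 0] ≠ 0, p = Projectivization.mk ℂ ![1, 0, 0] h) ∨
        (∃ h : ![(0 : ℂ), 1, 0] ≠ 0, p = Projectivization.mk ℂ ![0, 1, 0] h) ∨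
        (∃ h : ![(0 : ℂ), 0, 1] ≠ 0, p = Projectivization.mk ℂ ![0, 0, 1] h) := by
  have hn0 : n ≠ 0 := by omega
  constructor
  · induction p using Projectivization.ind with
    | h v hv =>
    rw [mk_mem_fermatPoints_iff hn hv]
    rintro (⟨h0, h1, h2⟩ | ⟨i, hi⟩)
    · left
      have root : ∀ y : ℂ, v 0 ^ n = y ^ n → ∃ α ∈ Finset.Icc 1 n, v 0 * ε ^ α = y := by
        intro y hy
        have : NeZero n := ⟨hn0⟩
        obtain ⟨α, hα, h⟩ := hε.eq_pow_of_pow_eq_one (ξ := y / v 0)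
          (by rw [div_pow, ← hy, div_self (pow_ne_zero _ h0)])
        have hy' : v 0 * ε ^ α = y := by rw [h]; field_simp
        -- The exponent found lies in `0, ..., n - 1`, while the range wanted is `1, ..., n`: trade
        -- 0 for `n`.
        rcases Nat.eq_zero_or_pos α with rfl | hpos
        · exact ⟨n, Finset.mem_Icc.2 ⟨by omega, le_rfl⟩, by rw [hε.pow_eq_one]; simpa using hy'⟩
        · exact ⟨α, Finset.mem_Icc.2 ⟨hpos, hα.le⟩, hy'⟩
      obtain ⟨α, hα, hα'⟩ := root _ h1
      obtain ⟨β, hβ, hβ'⟩ := root _ h2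
      refine ⟨α, hα, β, hβ, one_ne, ?_⟩
      rw [Projectivization.mk_eq_mk_iff']
      refine ⟨v 0, funext fun j => ?_⟩
      fin_cases j <;> simp [hα', hβ']
    · right
      have hvi : v = v i • Pi.single i 1 := by
        funext j
        by_cases hj : j = i
        · subst hj; simp
        · simp [hi j hj, hj]
      fin_cases i
      · left
        refine ⟨one_ne, ?_⟩
        rw [Projectivization.mk_eq_mk_iff']
        refine ⟨v 0, funext fun j => ?_⟩
        fin_cases j <;> simp [hi]
      · right; left
        refine ⟨fun h => by simpa using congrFun h 1, ?_⟩
        rw [Projectivization.mk_eq_mk_iff']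
        refine ⟨v 1, funext fun j => ?_⟩
        fin_cases j <;> simp [hi]
      · right; right
        refine ⟨fun h => by simpa using congrFun h 2, ?_⟩
        rw [Projectivization.mk_eq_mk_iff']
        refine ⟨v 2, funext fun j => ?_⟩
        fin_cases j <;> simp [hi]
  · rintro (⟨α, -, β, -, h, rfl⟩ | ⟨h, rfl⟩ | ⟨h, rfl⟩ | ⟨h, rfl⟩) <;>
      rw [mk_mem_fermatPoints_iff hn]
    · left
      simp [← pow_mul, mul_comm _ n, pow_mul ε n, hε.pow_eq_one]
    · exact Or.inr ⟨0, fun j hj => by fin_cases j <;> simp_all⟩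
    · exact Or.inr ⟨1, fun j hj => by fin_cases j <;> simp_all⟩
    · exact Or.inr ⟨2, fun j hj => by fin_cases j <;> simp_all⟩

/-- The vectors that represent the derived points. -/
def fermatVector (ε : ℂ) {n : ℕ} : (Fin n × Fin n) ⊕ Fin 3 → Fin 3 → ℂ
  | .inl q => ![1, ε ^ (q.1 : ℕ), ε ^ (q.2 : ℕ)]
  | .inr i => Pi.single i 1

theorem fermatVector_ne_zero (ε : ℂ) {n : ℕ} (q : (Fin n × Fin n) ⊕ Fin 3) :
    fermatVector ε q ≠ 0 := by
  rcases q with q | i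
  · exact one_ne
  · intro h; simpa [fermatVector] using congrFun h i

theorem ncard_fermatPoints {n : ℕ} (hn : 3 ≤ n) : (fermatPoints n).ncard = n ^ 2 + 3 := by
  have hn0 : n ≠ 0 := by omega
  obtain ⟨ε, hε⟩ : ∃ ε : ℂ, IsPrimitiveRoot ε n := ⟨_, Complex.isPrimitiveRoot_exp n hn0⟩
  have hε0 : ε ≠ 0 := hε.ne_zero hn0
  let g : (Fin n × Fin n) ⊕ Fin 3 → ProjSpace 2 := fun q =>
    Projectivization.mk ℂ (fermatVector ε q) (fermatVector_ne_zero ε q)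
  have hg : Function.Injective g := by
    intro q r hqr
    obtain ⟨k, hk⟩ := (Projectivization.mk_eq_mk_iff' ℂ _ _ _ _).1 hqr
    have k0 := congrFun hk 0
    have k1 := congrFun hk 1
    have k2 := congrFun hk 2
    rcases q with ⟨q1, q2⟩ | i <;> rcases r with ⟨r1, r2⟩ | j
    · simp only [fermatVector, Pi.smul_apply, smul_eq_mul, Matrix.cons_val] at k0 k1 k2
      rw [mul_one] at k0
      subst k0
      rw [one_mul] at k1 k2
      rw [Fin.ext (hε.pow_inj r1.2 q1.2 k1), Fin.ext (hε.pow_inj r2.2 q2.2 k2)]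
    · exfalso
      have p1 : ε ^ (q1 : ℕ) ≠ 0 := pow_ne_zero _ hε0
      fin_cases j <;> simp [fermatVector] at k0 k1 k2
      exact p1 k1.symm
    · exfalso
      fin_cases i <;> simp [fermatVector] at k0 k1 k2 <;> simp_all
    · have := congrFun hk i
      by_contra hne
      have hij : i ≠ j := fun h => hne (by rw [h])
      simp [fermatVector, hij] at this
  have hrange : fermatPoints n = Set.range g := by
    ext p
    rw [mem_fermatPoints_iff hn hε]
    constructor
    · rintro (⟨α, hα, β, hβ, h, rfl⟩ | ⟨h, rfl⟩ | ⟨h, rfl⟩ | ⟨h, rfl⟩)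
      · refine ⟨.inl (⟨α % n, Nat.mod_lt _ (by omega)⟩, ⟨β % n, Nat.mod_lt _ (by omega)⟩), ?_⟩
        simp only [g]
        congr 1
        simp [fermatVector, pow_mod_orderOf, hε.eq_orderOf]
      · refine ⟨.inr 0, ?_⟩
        simp only [g]
        congr 1
        funext j
        fin_cases j <;> simp [fermatVector]
      · refine ⟨.inr 1, ?_⟩
        simp only [g]
        congr 1
        funext j
        fin_cases j <;> simp [fermatVector]
      · refine ⟨.inr 2, ?_⟩
        simp only [g]
        congr 1
        funext j
        fin_cases j <;> simp [fermatVector]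
    · rintro ⟨q, rfl⟩
      rw [← mem_fermatPoints_iff hn hε, mk_mem_fermatPoints_iff hn]
      rcases q with q | i
      · left
        simp [fermatVector, ← pow_mul, mul_comm _ n, pow_mul ε n, hε.pow_eq_one]
      · exact Or.inr ⟨i, fun j hj => by simp [fermatVector, hj]⟩
  rw [hrange, Set.ncard_range_of_injective hg]
  simp [sq]

/-! ### Fourth-order vanishing by Taylor expansion -/

/-- The Taylor expansion of `(X + s) ^ (m + 3)` to third order in `s`. -/
theorem exists_taylor {R : Type*} [CommRing R] (X s : R) (m : ℕ) :
    ∃ r : R, 6 * (X + s) ^ (m + 3) = 6 * X ^ (m + 3) + 6 * (m + 3) * X ^ (m + 2) * s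
      + 3 * (m + 3) * (m + 2) * X ^ (m + 1) * s ^ 2
      + (m + 3) * (m + 2) * (m + 1) * X ^ m * s ^ 3 + s ^ 4 * r := by
  induction m with
  | zero => exact ⟨0, by push_cast; ring⟩
  | succ m ih =>
    obtain ⟨r, hr⟩ := ih
    -- Multiplying the expansion by `X + s` creates one new term of order 4: the cubic term times
    -- `s`.
    refine ⟨r * (X + s) + (m + 3) * (m + 2) * (m + 1) * X ^ m, ?_⟩
    rw [show m + 1 + 3 = (m + 3) + 1 by ring, pow_succ]
    push_cast
    linear_combination (X + s) * hr

theorem mul_form_mem {R : Type*} [CommRing R] (I : Ideal R) {s t : R} (hs : s ∈ I) (ht : t ∈ I)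
    (k0 k1 k2 k3 k4 : R) :
    s ^ 4 * k0 + s ^ 3 * t * k1 + s ^ 2 * t ^ 2 * k2 + s * t ^ 3 * k3 + t ^ 4 * k4 ∈ I ^ 4 := by
  have key : ∀ i j, i + j = 4 → s ^ i * t ^ j ∈ I ^ 4 := fun i j h => by
    rw [← h, pow_add]
    exact Ideal.mul_mem_mul (Ideal.pow_mem_pow hs i) (Ideal.pow_mem_pow ht j)
  have h0 := key 4 0 rfl
  have h1 := key 3 1 rfl
  have h2 := key 2 2 rfl
  have h3 := key 1 3 rfl
  have h4 := key 0 4 rfl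
  simp only [pow_zero, pow_one, mul_one, one_mul] at h0 h1 h3 h4
  exact add_mem (add_mem (add_mem (add_mem (Ideal.mul_mem_right _ _ h0)
    (Ideal.mul_mem_right _ _ h1)) (Ideal.mul_mem_right _ _ h2)) (Ideal.mul_mem_right _ _ h3))
    (Ideal.mul_mem_right _ _ h4)

/-- The form `Q_P` in rescaled coordinates, with `A`, `B`, `D` in the role of `a ^ n`, `b ^ n`, `c ^
n` and `n = m + 3`. The factor 12 is 6 from the Taylor expansion times 2 from the binomials `u`,
`v`, `w`; it keeps all coefficients integral. -/
theorem twelve_mul_mem {R : Type*} [CommRing R] (I : Ideal R) {s t : R} (hs : s ∈ I) (ht : t ∈ I)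
    (m : ℕ) (a b c A B D X Y Z XN YN ZN u v w : R)
    (hY : Y = X + s) (hZ : Z = X + t) (hXN : XN = X ^ (m + 3)) (hYN : YN = Y ^ (m + 3))
    (hZN : ZN = Z ^ (m + 3)) (hu : 2 * u = (m + 3) * (m + 2) - 2) (hv : 2 * v = (m + 2) * (m + 1))
    (hw : 2 * w = (m + 4) * (m + 3)) :
    12 * (a * b * c * (
      - X * Y * ((u * B + v * D) * (D * ZN - A * XN) + (u * A + v * D) * (B * YN - D * ZN))
      - X * Z * ((u * A + v * B) * (B * YN - D * ZN) + (u * D + v * B) * (A * XN - B * YN))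
      - Y * Z * ((u * B + v * A) * (D * ZN - A * XN) + (u * D + v * A) * (A * XN - B * YN))
      + w * A * X ^ 2 * (B * YN - D * ZN) + w * B * Y ^ 2 * (D * ZN - A * XN)
      + w * D * Z ^ 2 * (A * XN - B * YN))) ∈ I ^ 4 := by
  obtain ⟨r₁, h₁⟩ := exists_taylor X s m
  obtain ⟨r₂, h₂⟩ := exists_taylor X t m
  rw [← hY, ← hYN] at h₁
  rw [← hZ, ← hZN] at h₂
  set U : R := (m + 3) * (m + 2) - 2 with hU
  set V : R := (m + 2) * (m + 1) with hV
  set W : R := (m + 4) * (m + 3) with hW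
  set cY : R := - X * Y * (U * A + V * D) - X * Z * (U * (A - D)) + Y * Z * (U * D + V * A)
    + W * A * X ^ 2 - W * D * Z ^ 2 with hcY
  set cZ : R := X * Y * (U * (A - B)) + X * Z * (U * A + V * B) - Y * Z * (U * B + V * A)
    - W * A * X ^ 2 + W * B * Y ^ 2 with hcZ
  set T : R := (m + 3) * (m + 2) * (m + 1) * X ^ m with hT
  set S : R := 3 * (m + 3) * (m + 2) * X ^ (m + 1) with hS
  -- The cofactors of `s ^ 4`, `s ^ 3 t`, `s ^ 2 t ^ 2`, `s t ^ 3`, `t ^ 4`, collected after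
  -- substituting the expansions. The remainders `r₁` and `r₂` enter only the first and the last.
  have := mul_form_mem I hs ht
    (a * b * c * (B * (r₁ * cY + T * X * (-(U * A + V * D) + (U * D + V * A)))))
    (a * b * c * (B * (T * (X * (-(U * (A - D)) + (U * D + V * A) - 2 * W * D) + s * (U * D + V * A)
      - W * D * t) + S * (U * D + V * A))))
    (a * b * c * (- B * S * (W * D) + D * S * (W * B)))
    (a * b * c * (D * (T * (X * (U * (A - B) - (U * B + V * A) + 2 * W * B) - t * (U * B + V * A)
      + W * B * s) - S * (U * B + V * A))))
    (a * b * c * (D * (r₂ * cZ + T * X * ((U * A + V * B) - (U * B + V * A)))))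
  convert this using 1
  -- Sort by the `n`-th powers, so that each expansion can be substituted once.
  have step : 12 * (
      - X * Y * ((u * B + v * D) * (D * ZN - A * XN) + (u * A + v * D) * (B * YN - D * ZN))
      - X * Z * ((u * A + v * B) * (B * YN - D * ZN) + (u * D + v * B) * (A * XN - B * YN))
      - Y * Z * ((u * B + v * A) * (D * ZN - A * XN) + (u * D + v * A) * (A * XN - B * YN))
      + w * A * X ^ 2 * (B * YN - D * ZN) + w * B * Y ^ 2 * (D * ZN - A * XN)
      + w * D * Z ^ 2 * (A * XN - B * YN)) =
      A * (6 * XN) * (X * Y * (U * B + V * D) - X * Z * (U * D + V * B)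
        + Y * Z * (U * (B - D)) - W * B * Y ^ 2 + W * D * Z ^ 2)
      + B * (6 * YN) * cY + D * (6 * ZN) * cZ := by
    rw [hcY, hcZ, ← hu, ← hv, ← hw]
    ring
  rw [show ∀ q : R, 12 * (a * b * c * q) = a * b * c * (12 * q) by intro q; ring, step, h₁, h₂,
    hcY, hcZ, hXN, hY, hZ, hU, hV, hW, hT, hS]
  ring

/-! ### Forms of degree `n + 2` through the derived points -/

theorem sum_pow_eq_ite {n : ℕ} {ω : ℂ} (h : ω ^ n = 1) [Decidable (ω = 1)] :
    ∑ i ∈ Finset.range n, ω ^ i = if ω = 1 then (n : ℂ) else 0 := by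
  split_ifs with h1
  · simp [h1]
  · rw [geom_sum_eq h1, h, sub_self, zero_div]

/-- If `f (1, ε ^ α, ε ^ β)` vanishes for all `α` and `β`, the coefficients of `f` add up to zero
over each residue class modulo `n` of the exponents of the last two variables. -/
theorem sum_coeff_residue_eq_zero {n : ℕ} (hn : n ≠ 0) {ε : ℂ} (hε : IsPrimitiveRoot ε n)
    {f : CoordRing 2} (hf : ∀ α β : ℕ, eval ![1, ε ^ α, ε ^ β] f = 0) (j k : ℕ) :
    ∑ d ∈ f.support with d 1 ≡ j [MOD n] ∧ d 2 ≡ k [MOD n], coeff d f = 0 := by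
  classical
  have hε0 : ε ≠ 0 := hε.ne_zero hn
  have root : ∀ i j : ℕ, (ε ^ i / ε ^ j) ^ n = 1 := fun i j => by
    rw [div_pow, ← pow_mul, ← pow_mul, mul_comm i, mul_comm j, pow_mul, pow_mul, hε.pow_eq_one]
    simp
  have eq_one : ∀ i j : ℕ, ε ^ i / ε ^ j = 1 ↔ i ≡ j [MOD n] := fun i j => by
    rw [div_eq_one_iff_eq (pow_ne_zero _ hε0), hε.eq_orderOf]
    exact (hε.isOfFinOrder hn).pow_eq_pow_iff_modEq
  -- Orthogonality of characters: weighting the values on the grid by the inverse character of `(j,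
  -- k)` leaves `n ^ 2` times the sum over that residue class.
  have h : ∑ α ∈ Finset.range n, ∑ β ∈ Finset.range n,
      ((ε ^ j)⁻¹ ^ α * (ε ^ k)⁻¹ ^ β) * eval ![1, ε ^ α, ε ^ β] f = 0 :=
    Finset.sum_eq_zero fun α _ => Finset.sum_eq_zero fun β _ => by rw [hf, mul_zero]
  have h2 : ∑ d ∈ f.support, coeff d f *
      ((∑ α ∈ Finset.range n, (ε ^ d 1 / ε ^ j) ^ α) *
        ∑ β ∈ Finset.range n, (ε ^ d 2 / ε ^ k) ^ β) = 0 := by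
    rw [← h]
    simp only [eval_eq', Finset.mul_sum, Finset.sum_mul]
    rw [Finset.sum_congr rfl fun d _ => Finset.sum_comm, Finset.sum_comm]
    refine Finset.sum_congr rfl fun α _ => ?_
    rw [Finset.sum_comm]
    refine Finset.sum_congr rfl fun β _ => Finset.sum_congr rfl fun d _ => ?_
    simp only [Fin.prod_univ_three, Matrix.cons_val, one_pow, one_mul, div_eq_mul_inv, mul_pow,
      ← pow_mul]
    rw [mul_comm α, mul_comm β]
    ring
  simp only [sum_pow_eq_ite (root _ _), eq_one] at h2
  rw [Finset.sum_filter]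
  have hn2 : (n : ℂ) * n ≠ 0 := by simpa using hn
  refine (mul_eq_zero.1 (?_ : (n : ℂ) * n * _ = 0)).resolve_left hn2
  refine Eq.trans ?_ h2
  rw [Finset.mul_sum]
  refine Finset.sum_congr rfl fun d _ => ?_
  by_cases h1 : d 1 ≡ j [MOD n] <;> by_cases h3 : d 2 ≡ k [MOD n] <;> simp [h1, h3]
  ring

theorem eval_eq_zero_of_mem_pointsIdeal {n : ℕ} (hn : 3 ≤ n) {f : CoordRing 2}
    (hf : f ∈ pointsIdeal (fermatPoints n)) {v : Fin 3 → ℂ}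
    (hv : (v 0 ≠ 0 ∧ v 0 ^ n = v 1 ^ n ∧ v 0 ^ n = v 2 ^ n) ∨ ∃ i, ∀ j, j ≠ i → v j = 0)
    (h0 : v ≠ 0) : eval v f = 0 := by
  have := mem_pointsIdeal.1 hf _ ((mk_mem_fermatPoints_iff hn h0).2 hv)
  simpa using (vanishesAt_mk h0).1 this 1

/-- The exponent vector of degree `d` with the last two exponents `q`. -/
noncomputable def exponent (d : ℕ) (q : ℕ × ℕ) : Fin 3 →₀ ℕ :=
  Finsupp.equivFunOnFinite.symm ![d - q.1 - q.2, q.1, q.2]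

theorem eq_exponent {d : ℕ} {e : Fin 3 →₀ ℕ} (h : e.degree = d) : e = exponent d (e 1, e 2) := by
  have : e 0 + e 1 + e 2 = d := by rw [← h, Finsupp.degree_eq_sum, Fin.sum_univ_three]
  ext i
  fin_cases i
  · simp [exponent]; omega
  · simp [exponent]
  · simp [exponent]

/-- A form of degree `d` that vanishes at the `i`-th coordinate point lacks the `d`-th power of `X i`. -/
theorem coeff_single_eq_zero {f : CoordRing 2} {d : ℕ} (hf : f.IsHomogeneous d) (i : Fin 3)
    (h : eval (Pi.single i 1) f = 0) : coeff (Finsupp.single i d) f = 0 := by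
  rw [eval_eq', Finset.sum_eq_single (Finsupp.single i d)] at h
  · rw [Finset.prod_eq_one, mul_one] at h
    · exact h
    · intro j _
      by_cases hj : j = i
      · subst hj; simp
      · simp [Finsupp.single_eq_of_ne hj]
  · intro e he hne
    obtain ⟨j, hj, hej⟩ : ∃ j, j ≠ i ∧ e j ≠ 0 := by
      by_contra! hcon
      have hs : e = Finsupp.single i (e i) := by
        ext j
        by_cases hj : j = i
        · subst hj; simp
        · simp [hcon j hj, Finsupp.single_eq_of_ne hj]
      have hdeg : e.degree = d := by
        by_contra hd'
        exact (mem_support_iff.1 he) (hf.coeff_eq_zero hd')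
      rw [hs, Finsupp.degree_single] at hdeg
      exact hne (by rw [hs, hdeg])
    rw [Finset.prod_eq_zero (Finset.mem_univ j) (by simp [hj, hej]), mul_zero]
  · intro hns
    rw [notMem_support_iff.1 hns, zero_mul]

/-- Exponents of the last two variables in ten monomials of degree `n + 2` whose coefficients
determine a form of that degree that vanishes at the derived points. -/
def determiningExponents (n : ℕ) : Fin 10 → ℕ × ℕ :=
  ![(n, 0), (n, 1), (n, 2), (n + 1, 0), (n + 1, 1), (0, n), (1, n), (2, n), (0, n + 1), (1, n + 1)]

theorem exists_determiningExponents {n j k : ℕ} (h : j + k ≤ n + 2) (h' : n ≤ j ∨ n ≤ k) :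
    (∃ i, (j, k) = determiningExponents n i) ∨ (j, k) = (n + 2, 0) ∨ (j, k) = (0, n + 2) := by
  rcases h' with h' | h'
  · obtain ⟨l, rfl⟩ := Nat.exists_eq_add_of_le h'
    obtain ⟨rfl, rfl⟩ | ⟨rfl, rfl⟩ | ⟨rfl, rfl⟩ | ⟨rfl, rfl⟩ | ⟨rfl, rfl⟩ | ⟨rfl, rfl⟩ :
        (l = 0 ∧ k = 0) ∨ (l = 0 ∧ k = 1) ∨ (l = 0 ∧ k = 2) ∨ (l = 1 ∧ k = 0) ∨
        (l = 1 ∧ k = 1) ∨ (l = 2 ∧ k = 0) := by omega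
    exacts [.inl ⟨0, rfl⟩, .inl ⟨1, rfl⟩, .inl ⟨2, rfl⟩, .inl ⟨3, rfl⟩, .inl ⟨4, rfl⟩,
      .inr (.inl rfl)]
  · obtain ⟨l, rfl⟩ := Nat.exists_eq_add_of_le h'
    obtain ⟨rfl, rfl⟩ | ⟨rfl, rfl⟩ | ⟨rfl, rfl⟩ | ⟨rfl, rfl⟩ | ⟨rfl, rfl⟩ | ⟨rfl, rfl⟩ :
        (l = 0 ∧ j = 0) ∨ (l = 0 ∧ j = 1) ∨ (l = 0 ∧ j = 2) ∨ (l = 1 ∧ j = 0) ∨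
        (l = 1 ∧ j = 1) ∨ (l = 2 ∧ j = 0) := by omega
    exacts [.inl ⟨5, rfl⟩, .inl ⟨6, rfl⟩, .inl ⟨7, rfl⟩, .inl ⟨8, rfl⟩, .inl ⟨9, rfl⟩,
      .inr (.inr rfl)]

/-- The ten monomials, together with `y ^ (n + 2)` and `z ^ (n + 2)`, which the coordinate points
exclude, are all those with an exponent of `y` or `z` at least `n`. Once they are gone, each residue
class modulo `n` contains at most one remaining monomial, and the vanishing class sum is its
coefficient. -/
theorem eq_zero_of_coeff_determiningExponents {n : ℕ} (hn : 3 ≤ n) {f : CoordRing 2}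
    (hf : f.IsHomogeneous (n + 2)) (hZ : f ∈ pointsIdeal (fermatPoints n))
    (h : ∀ i, coeff (exponent (n + 2) (determiningExponents n i)) f = 0) : f = 0 := by
  classical
  have hn0 : n ≠ 0 := by omega
  obtain ⟨ε, hε⟩ : ∃ ε : ℂ, IsPrimitiveRoot ε n := ⟨_, Complex.isPrimitiveRoot_exp n hn0⟩
  have hgrid : ∀ α β : ℕ, eval ![1, ε ^ α, ε ^ β] f = 0 := fun α β =>
    eval_eq_zero_of_mem_pointsIdeal hn hZ
      (Or.inl (by simp [← pow_mul, mul_comm _ n, pow_mul ε n, hε.pow_eq_one])) one_ne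
  have hcoord : ∀ i : Fin 3, coeff (Finsupp.single i (n + 2)) f = 0 := fun i =>
    coeff_single_eq_zero hf i (eval_eq_zero_of_mem_pointsIdeal hn hZ
      (Or.inr ⟨i, fun j hj => by simp [hj]⟩) (by simp))
  have hsum : ∀ d ∈ f.support, d 0 + d 1 + d 2 = n + 2 := fun d hd => by
    have hdeg : d.degree = n + 2 := by
      by_contra hd'
      exact (mem_support_iff.1 hd) (hf.coeff_eq_zero hd')
    rw [← hdeg, Finsupp.degree_eq_sum, Fin.sum_univ_three]
  have hdeg : ∀ d ∈ f.support, d.degree = n + 2 := fun d hd => by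
    rw [← hsum d hd, Finsupp.degree_eq_sum, Fin.sum_univ_three]
  have hlt : ∀ d ∈ f.support, d 1 < n ∧ d 2 < n := by
    intro d hd
    by_contra hcon
    refine mem_support_iff.1 hd ?_
    have hs := hsum d hd
    have hcases : (∃ i, (d 1, d 2) = determiningExponents n i) ∨ (d 1, d 2) = (n + 2, 0) ∨
        (d 1, d 2) = (0, n + 2) :=
      exists_determiningExponents (by omega) (by omega)
    rw [eq_exponent (hdeg d hd)]
    rcases hcases with ⟨i, hi⟩ | hi | hi
    · rw [hi]; exact h i
    · rw [hi, ← hcoord 1]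
      congr 1
      ext j
      fin_cases j <;> simp [exponent]
    · rw [hi, ← hcoord 2]
      congr 1
      ext j
      fin_cases j <;> simp [exponent]
  ext d
  rw [coeff_zero]
  by_contra hd
  have hd := mem_support_iff.2 hd
  have := sum_coeff_residue_eq_zero hn0 hε hgrid (d 1) (d 2)
  rw [Finset.sum_eq_single d] at this
  · exact mem_support_iff.1 hd this
  · intro e he hne
    obtain ⟨he, h1, h2⟩ := Finset.mem_filter.1 he
    exfalso
    refine hne ?_
    rw [eq_exponent (hdeg d hd), eq_exponent (hdeg e he),
      h1.eq_of_lt_of_lt (hlt e he).1 (hlt d hd).1, h2.eq_of_lt_of_lt (hlt e he).2 (hlt d hd).2]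
  · intro hns
    exact absurd (Finset.mem_filter.2 ⟨hd, rfl, rfl⟩) hns

theorem h0_pointsIdeal_le {n : ℕ} (hn : 3 ≤ n) : h0 (n + 2) (pointsIdeal (fermatPoints n)) ≤ 10 := by
  let φ : CoordRing 2 →ₗ[ℂ] (Fin 10 → ℂ) :=
    LinearMap.pi fun i => lcoeff ℂ (exponent (n + 2) (determiningExponents n i))
  have := LinearMap.finrank_le_finrank_of_injective (f := φ.domRestrict
    (homogeneousSubmodule (Fin (2 + 1)) ℂ (n + 2) ⊓
      (pointsIdeal (fermatPoints n)).restrictScalars ℂ)) (by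
    rw [injective_iff_map_eq_zero]
    rintro ⟨f, hf, hZ⟩ h
    exact Subtype.ext (eq_zero_of_coeff_determiningExponents hn hf hZ fun i => congrFun h i))
  simpa [h0] using this

theorem h0_pos {N d : ℕ} {I : Ideal (CoordRing N)} {f : CoordRing N} (hf : f.IsHomogeneous d)
    (hI : f ∈ I) (h : f ≠ 0) : 0 < h0 d I := by
  -- Finiteness is essential: `finrank` takes the value 0 on an infinite-dimensional space.
  have : Module.Finite ℂ (homogeneousSubmodule (Fin (N + 1)) ℂ d) :=
    Module.Finite.iff_fg.2 (homogeneousSubmodule_fg _ _ d)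
  have : Module.Finite ℂ ↥(homogeneousSubmodule (Fin (N + 1)) ℂ d ⊓ I.restrictScalars ℂ) :=
    Submodule.finiteDimensional_inf_left _ _
  have : Nontrivial ↥(homogeneousSubmodule (Fin (N + 1)) ℂ d ⊓ I.restrictScalars ℂ) :=
    ⟨⟨f, hf, hI⟩, 0, fun h' => h (congrArg Subtype.val h')⟩
  exact Module.finrank_pos

/-! ### The polynomial `Q_P`: zeros at `Z`, degree, multiplicity at least 4 -/

theorem two_mul_choose_cast (m : ℕ) :
    2 * (((m + 3).choose 2 : ℂ) - 1) = (m + 3) * (m + 2) - 2 ∧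
    2 * ((m + 3 - 1).choose 2 : ℂ) = (m + 2) * (m + 1) ∧
    2 * ((m + 3 + 1).choose 2 : ℂ) = (m + 4) * (m + 3) := by
  rw [show m + 3 - 1 = m + 2 by omega]
  simp only [Nat.cast_choose_two]
  push_cast
  refine ⟨?_, ?_, ?_⟩ <;> ring

theorem unexpectedPolynomial_vanishesAt {n : ℕ} (hn : 3 ≤ n) (a b c : ℂ) {p : ProjSpace 2}
    (hp : p ∈ fermatPoints n) : VanishesAt (unexpectedPolynomial n a b c) p := by
  have hn0 : n ≠ 0 := by omega
  induction p using Projectivization.ind with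
  | h v hv =>
  rw [mk_mem_fermatPoints_iff hn hv] at hp
  rw [vanishesAt_mk]
  intro k
  rcases hp with ⟨-, h1, h2⟩ | ⟨i, hi⟩
  · simp [unexpectedPolynomial, mul_pow, ← h1, ← h2]
  · fin_cases i
    · have h1 := hi 1 (by decide)
      have h2 := hi 2 (by decide)
      simp [unexpectedPolynomial, h1, h2, hn0]
    · have h1 := hi 0 (by decide)
      have h2 := hi 2 (by decide)
      simp [unexpectedPolynomial, h1, h2, hn0]
    · have h1 := hi 0 (by decide)
      have h2 := hi 1 (by decide)
      simp [unexpectedPolynomial, h1, h2, hn0]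

theorem isHomogeneous_unexpectedPolynomial (n : ℕ) (a b c : ℂ) :
    (unexpectedPolynomial n a b c).IsHomogeneous (n + 2) := by
  have hX : ∀ i : Fin 3, (X i : CoordRing 2).IsHomogeneous 1 := fun i => isHomogeneous_X _ i
  have hp : ∀ (i : Fin 3) (k : ℕ), ((X i : CoordRing 2) ^ k).IsHomogeneous k := fun i k =>
    isHomogeneous_X_pow i k
  have hd : ∀ i j : Fin 3, ((X i : CoordRing 2) ^ n - X j ^ n).IsHomogeneous n := fun i j =>
    (hp i n).sub (hp j n)
  have h1 : ∀ (q r s : ℂ) (i j k l m o : Fin 3),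
      (C q * X i * X j * (C r * ((X k : CoordRing 2) ^ n - X l ^ n) + C s * (X m ^ n - X o ^ n))
        ).IsHomogeneous (n + 2) := fun q r s i j k l m o => by
    have := (((hX i).C_mul q).mul (hX j)).mul (((hd k l).C_mul r).add ((hd m o).C_mul s))
    rwa [show 1 + 1 + n = n + 2 by ring] at this
  have h2 : ∀ (q : ℂ) (i k l : Fin 3),
      (C q * (X i : CoordRing 2) ^ 2 * (X k ^ n - X l ^ n)).IsHomogeneous (n + 2) :=
    fun q i k l => by
    have := ((hp i 2).C_mul q).mul (hd k l)
    convert this using 1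
    omega
  simp only [unexpectedPolynomial, ← C_neg]
  exact (((((h1 _ _ _ 0 1 2 0 1 2).sub (h1 _ _ _ 0 2 1 2 0 1)).sub (h1 _ _ _ 1 2 2 0 0 1)).add
    (h2 _ 0 1 2)).add (h2 _ 1 2 0)).add (h2 _ 2 0 1)

theorem unexpectedPolynomial_mem {n : ℕ} (hn : 3 ≤ n) {a b c : ℂ} (ha : a ≠ 0) (hb : b ≠ 0)
    (hc : c ≠ 0) (h : ![a, b, c] ≠ 0) :
    unexpectedPolynomial n a b c ∈ pointIdeal (Projectivization.mk ℂ ![a, b, c] h) ^ 4 := by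
  obtain ⟨m, rfl⟩ := Nat.exists_eq_add_of_le' hn
  set I := pointIdeal (Projectivization.mk ℂ ![a, b, c] h) with hI
  have hs : C b⁻¹ * X 1 - C a⁻¹ * X 0 ∈ I := by
    rw [hI, mem_pointIdeal, vanishesAt_mk]
    intro k
    simp
    field_simp
    simp
  have ht : C c⁻¹ * X 2 - C a⁻¹ * X 0 ∈ I := by
    rw [hI, mem_pointIdeal, vanishesAt_mk]
    intro k
    simp
    field_simp
    simp
  obtain ⟨hu, hv, hw⟩ := two_mul_choose_cast m
  set u : ℂ := ((m + 3).choose 2 : ℂ) - 1 with hu'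
  set v : ℂ := ((m + 3 - 1).choose 2 : ℂ) with hv'
  set w : ℂ := ((m + 3 + 1).choose 2 : ℂ) with hw'
  have hu₁ := congrArg (C : ℂ → CoordRing 2) hu
  have hv₁ := congrArg (C : ℂ → CoordRing 2) hv
  have hw₁ := congrArg (C : ℂ → CoordRing 2) hw
  simp only [map_mul, map_add, map_sub, map_natCast, map_ofNat, map_one] at hu₁ hv₁ hw₁
  have key := twelve_mul_mem I hs ht m (C a) (C b) (C c) (C a ^ (m + 3)) (C b ^ (m + 3))
    (C c ^ (m + 3)) (C a⁻¹ * X 0) (C b⁻¹ * X 1) (C c⁻¹ * X 2) _ _ _ (C u) (C v) (C w)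
    (by ring) (by ring) rfl rfl rfl
    hu₁ hv₁ hw₁
  have hx : (X 0 : CoordRing 2) = C a * (C a⁻¹ * X 0) := by
    rw [← mul_assoc, ← C_mul, mul_inv_cancel₀ ha, C_1, one_mul]
  have hy : (X 1 : CoordRing 2) = C b * (C b⁻¹ * X 1) := by
    rw [← mul_assoc, ← C_mul, mul_inv_cancel₀ hb, C_1, one_mul]
  have hz : (X 2 : CoordRing 2) = C c * (C c⁻¹ * X 2) := by
    rw [← mul_assoc, ← C_mul, mul_inv_cancel₀ hc, C_1, one_mul]
  have h12 : 12 * unexpectedPolynomial (m + 3) a b c ∈ I ^ 4 := by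
    convert key using 2
    simp only [unexpectedPolynomial, ← hu', ← hv', ← hw']
    simp only [show m + 3 - 1 = m + 2 from rfl]
    generalize (C a⁻¹ * X 0 : CoordRing 2) = x at *
    generalize (C b⁻¹ * X 1 : CoordRing 2) = y at *
    generalize (C c⁻¹ * X 2 : CoordRing 2) = z at *
    rw [hx, hy, hz]
    simp only [map_add, map_mul, map_pow, mul_pow]
    ring
  -- Over `ℂ` the auxiliary factor 12 is a unit.
  have := Ideal.mul_mem_left (I ^ 4) (C (12⁻¹ : ℂ)) h12
  rwa [← mul_assoc, show (12 : CoordRing 2) = C 12 from (map_ofNat C 12).symm, ← C_mul,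
    inv_mul_cancel₀ (by norm_num), C_1, one_mul] at this

/-! ### Multiplicity exactly 4 by restriction to a line -/

/-- The restriction of a polynomial to the line `v + t w`. -/
noncomputable def restrictLine {N : ℕ} (v w : Fin (N + 1) → ℂ) : CoordRing N →ₐ[ℂ] Polynomial ℂ :=
  aeval fun i => Polynomial.C (v i) + Polynomial.C (w i) * Polynomial.X

theorem eval_zero_restrictLine {N : ℕ} (v w : Fin (N + 1) → ℂ) (f : CoordRing N) :
    (restrictLine v w f).eval 0 = eval v f := by
  induction f using MvPolynomial.induction_on with
  | C z => simp [restrictLine, algHom_C]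
  | add f g hf hg => simp [hf, hg]
  | mul_X f i hf => rw [map_mul, Polynomial.eval_mul, hf]; simp [restrictLine]

/-- The parameter value 0 corresponds to `v`, so restriction maps the point ideal into `(X)` and its
`k`-th power into `(X ^ k)`. -/
theorem X_pow_dvd_restrictLine {N : ℕ} {f : CoordRing N} {v : Fin (N + 1) → ℂ} (hv : v ≠ 0)
    (w : Fin (N + 1) → ℂ) {k : ℕ} (hf : f ∈ pointIdeal (Projectivization.mk ℂ v hv) ^ k) :
    Polynomial.X ^ k ∣ restrictLine v w f := by
  have hle : (pointIdeal (Projectivization.mk ℂ v hv)).map (restrictLine v w).toRingHom ≤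
      Ideal.span {Polynomial.X} := by
    rw [Ideal.map_le_iff_le_comap]
    intro g hg
    rw [Ideal.mem_comap, Ideal.mem_span_singleton, Polynomial.X_dvd_iff,
      Polynomial.coeff_zero_eq_eval_zero]
    have h0 : eval v g = 0 := by
      simpa using (vanishesAt_mk hv).1 (mem_pointIdeal.1 hg) 1
    exact (eval_zero_restrictLine v w g).trans h0
  have := Ideal.mem_map_of_mem (restrictLine v w).toRingHom hf
  rw [Ideal.map_pow] at this
  have := Ideal.pow_right_mono hle k this
  rwa [Ideal.span_singleton_pow, Ideal.mem_span_singleton] at this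

/-- With direction `(0, b, 0)` the variable `y` becomes `b (1 + X)`, and only the powers `0, 1, 2,
n, n + 1` of `1 + X` occur; the first three do not reach degree 4. The other two contribute `(n + 1)
* n.choose 4 - (n - 2) * (n + 1).choose 4` up to the common factor, and `(n + 1) * n.choose 4 = (n -
3) * (n + 1).choose 4`. -/
theorem coeff_four_restrictLine {n : ℕ} (hn : 3 ≤ n) (a b c : ℂ) :
    (restrictLine ![a, b, c] ![0, b, 0] (unexpectedPolynomial n a b c)).coeff 4 =
      - (a * b * c * b ^ n * (a ^ n - c ^ n) * (n + 1).choose 4) := by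
  obtain ⟨m, rfl⟩ := Nat.exists_eq_add_of_le' hn
  obtain ⟨hu, hv, hw⟩ := two_mul_choose_cast m
  set u : ℂ := ((m + 3).choose 2 : ℂ) - 1 with hu'
  set v : ℂ := ((m + 3 - 1).choose 2 : ℂ) with hv'
  set w : ℂ := ((m + 3 + 1).choose 2 : ℂ) with hw'
  set A := a ^ (m + 3) with hA
  set B := b ^ (m + 3) with hB
  set D := c ^ (m + 3) with hD
  have key : restrictLine ![a, b, c] ![0, b, 0] (unexpectedPolynomial (m + 3) a b c) =
      Polynomial.C (a * b * c) * (
      Polynomial.C ((u * A + v * B) * D - (u * D + v * B) * A)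
      + Polynomial.C (-(u * B + v * D) * (D - A) + (u * A + v * D) * D - (u * B + v * A) * (D - A)
        - (u * D + v * A) * A) * (1 + Polynomial.X) ^ 1
      + Polynomial.C (w * B * (D - A)) * (1 + Polynomial.X) ^ 2
      + Polynomial.C ((w - u) * B * (A - D)) * (1 + Polynomial.X) ^ (m + 3)
      + Polynomial.C ((v - u) * B * (A - D)) * (1 + Polynomial.X) ^ (m + 3 + 1)) := by
    have hC : ∀ z : ℂ, restrictLine ![a, b, c] ![0, b, 0] (C z) = Polynomial.C z := fun z =>
      algHom_C _ z
    have h0 : restrictLine ![a, b, c] ![0, b, 0] (X 0) = Polynomial.C a := by simp [restrictLine]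
    have h1 : restrictLine ![a, b, c] ![0, b, 0] (X 1) =
        Polynomial.C b * (1 + Polynomial.X) := by simp [restrictLine, mul_add]
    have h2 : restrictLine ![a, b, c] ![0, b, 0] (X 2) = Polynomial.C c := by simp [restrictLine]
    simp only [unexpectedPolynomial, ← hu', ← hv', ← hw', hA, hB, hD]
    simp only [show m + 3 - 1 = m + 2 from rfl]
    simp only [map_add, map_sub, map_neg, map_mul, map_pow, hC, h0, h1, h2, mul_pow]
    ring
  have hch : ((m + 3).choose 4 : ℂ) * (m + 4) = ((m + 3 + 1).choose 4 : ℂ) * m := by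
    have := Nat.choose_mul_succ_eq (m + 3) 4
    rw [show m + 3 + 1 - 4 = m by omega] at this
    exact_mod_cast this
  rw [key, Polynomial.coeff_C_mul]
  simp only [Polynomial.coeff_add, Polynomial.coeff_C_mul, Polynomial.coeff_one_add_X_pow,
    Polynomial.coeff_C, show Nat.choose 1 4 = 0 from rfl, show Nat.choose 2 4 = 0 from rfl]
  have e1 : w - u = m + 4 := by linear_combination (hw - hu) / 2
  have e2 : v - u = - (m + 1) := by linear_combination (hv - hu) / 2
  rw [e1, e2]
  simp only [OfNat.ofNat_ne_zero, if_false]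
  push_cast
  linear_combination a * b * c * B * (A - D) * hch

/-! ### General points and the main theorem -/

/-- The form whose non-vanishing describes the general points. -/
noncomputable def generalForm (n : ℕ) : CoordRing 2 := X 0 * X 1 * X 2 * (X 0 ^ n - X 2 ^ n)

theorem isHomogeneous_generalForm (n : ℕ) : (generalForm n).IsHomogeneous (1 + 1 + 1 + n) :=
  (((isHomogeneous_X _ _).mul (isHomogeneous_X _ _)).mul (isHomogeneous_X _ _)).mul
    ((isHomogeneous_X_pow _ _).sub (isHomogeneous_X_pow _ _))

end FermatCurves

theorem mainTheorem2 (n : ℕ) (hn : 3 ≤ n) :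
    (∀ ε : ℂ, IsPrimitiveRoot ε n → ∀ p : FermatCurves.ProjSpace 2,
      p ∈ FermatCurves.fermatPoints n ↔
        (∃ α ∈ Finset.Icc 1 n, ∃ β ∈ Finset.Icc 1 n,
          ∃ h : ![1, ε ^ α, ε ^ β] ≠ 0, p = Projectivization.mk ℂ ![1, ε ^ α, ε ^ β] h) ∨
        (∃ h : ![(1 : ℂ), 0, 0] ≠ 0, p = Projectivization.mk ℂ ![1, 0, 0] h) ∨
        (∃ h : ![(0 : ℂ), 1, 0] ≠ 0, p = Projectivization.mk ℂ ![0, 1, 0] h) ∨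
        (∃ h : ![(0 : ℂ), 0, 1] ≠ 0, p = Projectivization.mk ℂ ![0, 0, 1] h)) ∧
    (FermatCurves.fermatPoints n).ncard = n ^ 2 + 3 ∧
    ∃ U : Set (FermatCurves.ProjSpace 2), FermatCurves.IsZariskiOpen U ∧ U.Nonempty ∧
      ∀ (a b c : ℂ) (h : ![a, b, c] ≠ 0), Projectivization.mk ℂ ![a, b, c] h ∈ U →
        (∀ p ∈ FermatCurves.fermatPoints n,
          FermatCurves.VanishesAt (FermatCurves.unexpectedPolynomial n a b c) p) ∧
        FermatCurves.VanishesToOrder (FermatCurves.unexpectedPolynomial n a b c)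
          (Projectivization.mk ℂ ![a, b, c] h) 4 ∧
        FermatCurves.DefinesUnexpected (FermatCurves.unexpectedPolynomial n a b c) (n + 2)
          (FermatCurves.fermatPoints n) 4 (Projectivization.mk ℂ ![a, b, c] h) := by
  refine ⟨fun ε hε p => FermatCurves.mem_fermatPoints_iff hn hε p,
    FermatCurves.ncard_fermatPoints hn,
    {p | ∃ f ∈ ({FermatCurves.generalForm n} : Set _), ¬ FermatCurves.VanishesAt f p},
    ⟨_, ?_, rfl⟩, ?_, ?_⟩
  · rintro f rfl
    exact ⟨_, FermatCurves.isHomogeneous_generalForm n⟩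
  -- At `(1 : 1 : 2)` the form could vanish only if `2 ^ n = 1`.
  · refine ⟨Projectivization.mk ℂ ![1, 1, 2] FermatCurves.one_ne, _, rfl, fun hvan => ?_⟩
    have h1 := (FermatCurves.vanishesAt_mk FermatCurves.one_ne).1 hvan 1
    simp [FermatCurves.generalForm, sub_eq_zero] at h1
    have h2 : (2 : ℕ) ^ n = 1 := by exact_mod_cast h1.symm
    rw [Nat.pow_eq_one] at h2
    omega
  · rintro a b c h ⟨f, rfl, hf⟩
    obtain ⟨ha, hb, hc, hac⟩ : a ≠ 0 ∧ b ≠ 0 ∧ c ≠ 0 ∧ a ^ n - c ^ n ≠ 0 := by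
      rw [FermatCurves.vanishesAt_mk] at hf
      push Not at hf
      obtain ⟨k, hk⟩ := hf
      simp only [FermatCurves.generalForm, map_mul, map_sub, map_pow, eval_X, Pi.smul_apply,
        smul_eq_mul, Matrix.cons_val, mul_pow, ← mul_sub, ne_eq, mul_eq_zero, not_or] at hk
      tauto
    have hmem := FermatCurves.unexpectedPolynomial_mem hn ha hb hc h
    have hnot : FermatCurves.unexpectedPolynomial n a b c ∉
        FermatCurves.pointIdeal (Projectivization.mk ℂ ![a, b, c] h) ^ (4 + 1) := by
      intro h5
      have h4 := (Polynomial.X_pow_dvd_iff.1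
        (FermatCurves.X_pow_dvd_restrictLine h ![0, b, 0] h5)) 4 (by norm_num)
      rw [FermatCurves.coeff_four_restrictLine hn] at h4
      have hch : ((n + 1).choose 4 : ℂ) ≠ 0 :=
        Nat.cast_ne_zero.2 (Nat.choose_pos (by omega)).ne'
      exact neg_ne_zero.2 (mul_ne_zero (mul_ne_zero (mul_ne_zero (mul_ne_zero (mul_ne_zero ha hb)
        hc) (pow_ne_zero n hb)) hac) hch) h4
    have hne : FermatCurves.unexpectedPolynomial n a b c ≠ 0 := fun h0 =>
      hnot (h0 ▸ Ideal.zero_mem _)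
    have hvan := fun p hp =>
      FermatCurves.unexpectedPolynomial_vanishesAt hn a b c (p := p) hp
    have hZ := FermatCurves.mem_pointsIdeal.2 hvan
    have hhom := FermatCurves.isHomogeneous_unexpectedPolynomial n a b c
    refine ⟨hvan, ⟨hmem, hnot⟩, hne, hhom, ⟨hZ, hmem⟩, ?_⟩
    have hpos := FermatCurves.h0_pos (I := FermatCurves.pointsIdeal (FermatCurves.fermatPoints n) ⊓
      FermatCurves.pointIdeal (Projectivization.mk ℂ ![a, b, c] h) ^ 4) hhom ⟨hZ, hmem⟩ hne
    have hle := FermatCurves.h0_pointsIdeal_le hn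
    have h10 : (2 + 4 - 1).choose 2 = 10 := rfl
    -- The expected dimension is at most `10 - 10 = 0`, and the actual one is positive.
    rw [h10, gt_iff_lt, max_lt_iff]
    constructor <;> push_cast <;> omega
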